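/- For a set $X$ and $n\in\mathbb{N}=\{0,1,2,\dots\}$ let $\sigma_n(2^X)=\{\chi_A : A\subseteq X,\ |A|\le n\}$, a compact subspace of $\{0,1\}^X$ with the product topology. For a compact Hausdorff space $K$ and a closed subspace $L\subseteq K$, let $C(K)$ and $C(L)$ be the Banach spaces of continuous real-valued functions with the supremum norm. An extension operator is a bounded linear operator $T:C(L)\to C(K)$ such that $(Tf)|_L=f$ for all $f\in C(L)$, and $\eta(L,K)\in[0,\infty]$ is the infimum of the norms of all extension operators $C(L)\to C(K)$ (with $\eta(L,K)=\infty$ if there is none). Let $m<n$ be natural numbers and let $X$ be a set with $|X|\ge\aleph_{n-1}$. Then the formula $$T_X(f)(\chi_A)=\begin{cases} f(\chi_A), & |A|\le m,\\[2pt] \displaystyle\sum_{B\subseteq A,\ |B|\le m}(-1)^{m-|B|}\binom{|A|-|B|-1}{m-|B|}f(\chi_B), & m<|A|\le n,\end{cases}$$ defines an extension operator $T_X:C(\sigma_m(2^X))\to C(\sigma_n(2^X))$, and $$\eta(\sigma_m(2^X),\sigma_n(2^X))=\|T_X\|=\sum_{k=0}^m\binom{n}{k}\binom{n-k-1}{m-k}.$$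 -/

import Mathlib

open scoped ENNReal

/-- A bounded linear operator `T : C(L) → C(K)`, for `L ⊆ K` compact subsets of a space `Z`, is an
extension operator if `T f` restricts to `f` on `L`, for every `f`. -/
def IsExtensionOperator {Z : Type*} [TopologicalSpace Z] {L K : Set Z} (hLK : L ⊆ K)
    [CompactSpace L] [CompactSpace K] (T : C(L, ℝ) →L[ℝ] C(K, ℝ)) : Prop :=
  ∀ (f : C(L, ℝ)) (x : L), T f (Set.inclusion hLK x) = f x

/-- `η(L, K)`: the infimum of the norms of the extension operators `C(L) → C(K)`
(it is `∞` if there is none). -/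
noncomputable def extensionConstant {Z : Type*} [TopologicalSpace Z] {L K : Set Z} (hLK : L ⊆ K)
    [CompactSpace L] [CompactSpace K] : ℝ≥0∞ :=
  ⨅ (T : C(L, ℝ) →L[ℝ] C(K, ℝ)) (_ : IsExtensionOperator hLK T), ENNReal.ofReal ‖T‖

open Classical in
/-- The characteristic function of a finite set `A`, as a point of `2^X`, which carries the product
topology of the discrete two-point space. -/
noncomputable def chi {X : Type*} (A : Finset X) : X → Bool := fun x => decide (x ∈ A)

/-- `σ_n(2^X)`: the characteristic functions of the subsets of `X` with at most `n` elements. -/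
def sigmaSet (X : Type*) (n : ℕ) : Set (X → Bool) :=
  {u | ∃ A : Finset X, A.card ≤ n ∧ chi A = u}

theorem sigmaSet_mono (X : Type*) {m n : ℕ} (h : m ≤ n) : sigmaSet X m ⊆ sigmaSet X n := by
  rintro u ⟨A, hA, rfl⟩
  exact ⟨A, hA.trans h, rfl⟩

/-- The point `χ_A` of `σ_n(2^X)`. -/
noncomputable def sigmaPoint {X : Type*} {n : ℕ} (A : Finset X) (hA : A.card ≤ n) :
    sigmaSet X n := ⟨chi A, A, hA, rfl⟩

theorem isClosed_sigmaSet (X : Type*) (n : ℕ) : IsClosed (sigmaSet X n) := by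
  classical
  have key : sigmaSet X n =
      ⋂ (s : Finset X) (_ : s.card = n + 1), ⋃ x ∈ s, {u : X → Bool | u x = false} := by
    ext u
    simp only [Set.mem_iInter, Set.mem_iUnion, Set.mem_setOf_eq, exists_prop]
    constructor
    · rintro ⟨A, hA, rfl⟩ s hs
      by_contra! hcon
      have hsub : s ⊆ A := by
        intro x hx
        have := hcon x hx
        simpa [chi] using this
      have := Finset.card_le_card hsub
      omega
    · intro h
      have hfin : {x | u x = true}.Finite := by
        by_contra hinf
        obtain ⟨t, ht, htc⟩ := Set.Infinite.exists_subset_card_eq hinf (n + 1)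
        obtain ⟨x, hx, hux⟩ := h t htc
        have : u x = true := ht hx
        simp [hux] at this
      refine ⟨hfin.toFinset, ?_, ?_⟩
      · by_contra! hlt
        obtain ⟨t, ht, htc⟩ := Finset.exists_subset_card_eq (Nat.succ_le_of_lt hlt)
        obtain ⟨x, hx, hux⟩ := h t htc
        have := ht hx
        simp [hux] at this
      · funext x
        simp [chi]
  rw [key]
  refine isClosed_iInter fun s => isClosed_iInter fun _ => ?_
  exact s.finite_toSet.isClosed_biUnion fun x _ => isClosed_eq (continuous_apply x) continuous_const

instance sigmaSet.compactSpace (X : Type*) (n : ℕ) : CompactSpace (sigmaSet X n) :=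
  isCompact_iff_compactSpace.mp (isClosed_sigmaSet X n).isCompact

open Classical in
/-- `T` is the canonical operator `C(σ_m(2^X)) → C(σ_n(2^X))`: it is given by
`(T f)(χ_A) = f(χ_A)` if `|A| ≤ m` and by
`(T f)(χ_A) = ∑_{B ⊆ A, |B| ≤ m} (-1)^(m-|B|) C(|A|-|B|-1, m-|B|) f(χ_B)` if `m < |A| ≤ n`.
These values determine `T`. -/
def IsCanonicalOperator {X : Type*} {m n : ℕ}
    (T : C(sigmaSet X m, ℝ) →L[ℝ] C(sigmaSet X n, ℝ)) : Prop :=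
  ∀ (f : C(sigmaSet X m, ℝ)) (A : Finset X) (hA : A.card ≤ n),
    (∀ hm : A.card ≤ m, T f (sigmaPoint A hA) = f (sigmaPoint A hm)) ∧
    (m < A.card → T f (sigmaPoint A hA) =
      ∑ B ∈ (A.powerset.filter fun B => B.card ≤ m).attach,
        (-1 : ℝ) ^ (m - B.1.card) * ((A.card - B.1.card - 1).choose (m - B.1.card) : ℝ) *
          f (sigmaPoint B.1 (Finset.mem_filter.mp B.2).2))

/-! Write `e_S(χ_A) = 1` if `S ⊆ A` and `0` otherwise. These monomials span a dense subspace of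
`C(σ_m)` (Stone–Weierstrass), and `e_S = 0` on `σ_m` when `|S| > m`. A binomial identity shows that
the canonical formula sends `e_S` to `e_S` for `|S| ≤ m`; with the bound by the sum of absolute
values of the coefficients, this gives continuity of the images and the upper bound for the norm.

For the lower bound, let `T` be any extension operator. Up to `ε`, `T e_R` depends only on the
coordinates in a finite set `F(R) ⊇ R`. As `|X| ≥ ℵ_{n-1}`, a free set argument gives `A` with `|A|
= n` and `A ∩ F(R) = R` for all `R ⊆ A`. Then `T e_R(χ_A)` is close to `T e_R(χ_R) = 1` whenever
`|R| ≤ m`, so at `χ_A` the operator `T` nearly agrees with the canonical one on the span of these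
`e_R`. That span contains a function with values `±1` on which the canonical operator attains the
bound (`sum_signFun_coeff`). -/

/-! ### Free sets -/

open Classical in
/-- A finite-valued set mapping on the finite subsets of a set with at least `ℵ_k` elements has a
free set with `k + 1` elements. -/
theorem exists_free_finset {X : Type*} (k : ℕ) (Y : Set X)
    (hY : Cardinal.aleph (k : Ordinal) ≤ Cardinal.mk Y) (F : Finset X → Finset X) :
    ∃ A : Finset X, (A : Set X) ⊆ Y ∧ A.card = k + 1 ∧ ∀ x ∈ A, x ∉ F (A.erase x) := by
  induction k generalizing Y F with
  | zero =>
    have hinf : Y.Infinite := by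
      rw [← Set.infinite_coe_iff, Cardinal.infinite_iff]
      simpa using hY
    obtain ⟨x, hxY, hx⟩ := hinf.exists_notMem_finset (F ∅)
    exact ⟨{x}, by simpa using hxY, by simp, by simpa using hx⟩
  | succ k ih =>
    have hlt : Cardinal.aleph (k : Ordinal) < Cardinal.aleph ((k + 1 : ℕ) : Ordinal) :=
      Cardinal.aleph_lt_aleph.2 (by exact_mod_cast Nat.lt_succ_self k)
    obtain ⟨Z, hZY, hZ⟩ := Cardinal.le_mk_iff_exists_subset.1 (hlt.le.trans hY)
    have hZinf : Infinite Z := by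
      rw [Cardinal.infinite_iff, hZ]
      exact Cardinal.aleph0_le_aleph _
    -- `Z` has only `ℵ_k` finite subsets, so `Z ∪ C` cannot cover `Y`. A point `p` outside it avoids
    -- `F B` for every finite `B ⊆ Z`, which is freeness at `p`; induction on `B ↦ F (insert p B)`
    -- gives freeness at the other points.
    let C : Set X := ⋃ B : Finset Z, (F (B.map (Function.Embedding.subtype _)) : Set X)
    have hC : Cardinal.mk C ≤ Cardinal.aleph (k : Ordinal) := by
      refine (Cardinal.mk_iUnion_le _).trans ?_
      rw [Cardinal.mk_finset_of_infinite, hZ]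
      refine (Cardinal.mul_le_max_of_aleph0_le_left (Cardinal.aleph0_le_aleph _)).trans ?_
      refine max_le le_rfl (ciSup_le' fun B => ?_)
      exact (Cardinal.lt_aleph0_of_finite _).le.trans (Cardinal.aleph0_le_aleph _)
    have hdiff : (Y \ (Z ∪ C)).Nonempty := by
      rw [Set.nonempty_iff_ne_empty, Ne, Set.sdiff_eq_empty]
      intro hsub
      have h1 : Cardinal.mk Y ≤ Cardinal.aleph (k : Ordinal) :=
        (Cardinal.mk_le_mk_of_subset hsub).trans ((Cardinal.mk_union_le _ _).trans
          (Cardinal.add_le_of_le (Cardinal.aleph0_le_aleph _) hZ.le hC))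
      exact absurd (hlt.trans_le hY) (not_lt.2 h1)
    obtain ⟨p, hpY, hp⟩ := hdiff
    obtain ⟨A, hAZ, hA, hfree⟩ := ih Z hZ.ge fun B => F (insert p B)
    have hpA : p ∉ A := fun h => hp (Or.inl (hAZ h))
    refine ⟨insert p A, ?_, by rw [Finset.card_insert_of_notMem hpA, hA], ?_⟩
    · rw [Finset.coe_insert]
      exact Set.insert_subset hpY (hAZ.trans hZY)
    · intro x hx
      rcases Finset.mem_insert.1 hx with rfl | hxA
      · rw [Finset.erase_insert hpA]
        intro h
        refine hp (Or.inr (Set.mem_iUnion.2 ⟨A.subtype (· ∈ Z), ?_⟩))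
        rwa [Finset.subtype_map_of_mem fun x hx => hAZ hx]
      · have hne : p ≠ x := fun h => hpA (h ▸ hxA)
        rw [Finset.erase_insert_of_ne hne]
        exact hfree x hxA

/-! ### Binomial identities and the norm formula -/

/-- The coefficients of the canonical operator. -/
def canonicalCoeff (m a b : ℕ) : ℝ := (-1) ^ (m - b) * ((a - b - 1).choose (m - b) : ℝ)

/-- Each coefficient is a partial alternating sum of the `C(N-j, i)`. Summing along `r = i + j`,
where `C(N,j) C(N-j,r-j) = C(N,r) C(r,j)`, leaves `C(N,r) (1-1)^r`, so only `r = 0` survives. -/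
theorem sum_choose_mul_canonicalCoeff {N M : ℕ} (h : M < N) :
    ∑ j ∈ Finset.range (M + 1), (N.choose j : ℝ) * canonicalCoeff M N j = 1 := by
  have h1 : ∀ j ∈ Finset.range (M + 1), (N.choose j : ℝ) * canonicalCoeff M N j =
      ∑ i ∈ Finset.range (M + 1 - j), (N.choose j : ℝ) * ((-1) ^ i * ((N - j).choose i : ℝ)) := by
    intro j hj
    have hj' : j ≤ M := Nat.lt_succ_iff.1 (Finset.mem_range.1 hj)
    have h2 := @Int.alternating_sum_range_choose_eq_choose (N - j - 1) (M - j)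
    rw [show N - j - 1 + 1 = N - j by omega, show M - j + 1 = M + 1 - j by omega] at h2
    rw [← Finset.mul_sum, canonicalCoeff]
    congr 1
    exact_mod_cast h2.symm
  rw [Finset.sum_congr rfl h1, ← Finset.sum_range_diag_flip (M + 1)
    fun j i => (N.choose j : ℝ) * ((-1) ^ i * ((N - j).choose i : ℝ))]
  have h3 : ∀ r ∈ Finset.range (M + 1), ∑ j ∈ Finset.range (r + 1),
      (N.choose j : ℝ) * ((-1) ^ (r - j) * ((N - j).choose (r - j) : ℝ)) =
      if r = 0 then 1 else 0 := by
    intro r _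
    have h4 : ∀ j ∈ Finset.range (r + 1),
        (N.choose j : ℝ) * ((-1) ^ (r - j) * ((N - j).choose (r - j) : ℝ)) =
        (N.choose r : ℝ) * (1 ^ j * (-1) ^ (r - j) * (r.choose j : ℝ)) := by
      intro j hj
      have h5 := Nat.choose_mul (n := N) (Nat.lt_succ_iff.1 (Finset.mem_range.1 hj))
      have h6 : (N.choose r : ℝ) * (r.choose j : ℝ) =
        (N.choose j : ℝ) * ((N - j).choose (r - j) : ℝ) := by exact_mod_cast h5
      linear_combination -((-1) ^ (r - j)) * h6
    rw [Finset.sum_congr rfl h4, ← Finset.mul_sum, ← add_pow]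
    rcases Nat.eq_zero_or_pos r with rfl | hr
    · simp
    · simp [hr.ne']
  rw [Finset.sum_congr rfl h3]
  simp

open Classical in
/-- The canonical operator reproduces the monomials of degree at most `m`. -/
theorem sum_canonicalCoeff_mul_ite {X : Type*} {m : ℕ} {A S : Finset X} (hA : m < A.card)
    (hS : S.card ≤ m) :
    ∑ B ∈ A.powerset, canonicalCoeff m A.card B.card *
      (if B.card ≤ m then (if S ⊆ B then 1 else 0) else 0) = if S ⊆ A then 1 else 0 := by
  by_cases hSA : S ⊆ A
  swap
  · rw [if_neg hSA]
    refine Finset.sum_eq_zero fun B hB => ?_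
    rw [if_neg (c := S ⊆ B) fun h => hSA (h.trans (Finset.mem_powerset.1 hB))]
    simp
  have hcard := Finset.card_sdiff_add_card_eq_card hSA
  -- The sets `B ⊇ S` are `S ∪ D` with `D ⊆ A \ S`, and the coefficient depends only on differences
  -- of cardinalities, so `S` may be removed from everything.
  have h1 : ∑ B ∈ A.powerset, canonicalCoeff m A.card B.card *
      (if B.card ≤ m then (if S ⊆ B then 1 else 0) else 0) =
      ∑ D ∈ (A \ S).powerset, (if D.card ≤ m - S.card then
        canonicalCoeff (m - S.card) (A \ S).card D.card else 0) := by
    symm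
    refine Finset.sum_of_injOn (fun D => S ∪ D) ?_ ?_ ?_ ?_
    · intro D hD E hE hDE
      have hd := Finset.subset_sdiff.1 (Finset.mem_powerset.1 hD)
      have he := Finset.subset_sdiff.1 (Finset.mem_powerset.1 hE)
      have h2 : (S ∪ D) \ S = (S ∪ E) \ S := congrArg (· \ S) hDE
      rwa [Finset.union_sdiff_cancel_left hd.2.symm,
        Finset.union_sdiff_cancel_left he.2.symm] at h2
    · intro D hD
      have hd := Finset.subset_sdiff.1 (Finset.mem_powerset.1 hD)
      exact Finset.mem_powerset.2 (Finset.union_subset hSA hd.1)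
    · intro B hB hB'
      rw [if_neg (c := S ⊆ B)]
      · simp
      · intro hSB
        refine hB' ⟨B \ S, ?_, Finset.union_sdiff_of_subset hSB⟩
        exact Finset.mem_powerset.2 (Finset.sdiff_subset_sdiff (Finset.mem_powerset.1 hB) subset_rfl)
    · intro D hD
      have hd := Finset.subset_sdiff.1 (Finset.mem_powerset.1 hD)
      have hc : (S ∪ D).card = S.card + D.card := Finset.card_union_of_disjoint hd.2.symm
      rw [if_pos (c := S ⊆ S ∪ D) Finset.subset_union_left, hc]
      by_cases hle : D.card ≤ m - S.card
      · rw [if_pos hle, if_pos (by omega), mul_one, canonicalCoeff, canonicalCoeff,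
          show m - S.card - D.card = m - (S.card + D.card) by omega,
          show (A \ S).card - D.card - 1 = A.card - (S.card + D.card) - 1 by omega]
      · rw [if_neg hle, if_neg (by omega), mul_zero]
  rw [h1, if_pos hSA, Finset.sum_powerset_apply_card
    (fun j => if j ≤ m - S.card then canonicalCoeff (m - S.card) (A \ S).card j else 0),
    ← sum_choose_mul_canonicalCoeff (show m - S.card < (A \ S).card by omega)]
  symm
  refine Finset.sum_subset_zero_on_sdiff ?_ ?_ ?_
  · intro j hj
    rw [Finset.mem_range] at *
    omega
  · intro j hj
    rw [Finset.mem_sdiff, Finset.mem_range, Finset.mem_range] at hj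
    rw [if_neg (by omega), smul_zero]
  · intro j hj
    rw [Finset.mem_range] at hj
    rw [if_pos (by omega), nsmul_eq_mul]

/-- The norm of the canonical operator `C(σ_m(2^X)) → C(σ_a(2^X))`. -/
def canonicalNorm (m a : ℕ) : ℝ :=
  ∑ k ∈ Finset.range (m + 1), (a.choose k : ℝ) * ((a - k - 1).choose (m - k) : ℝ)

theorem canonicalNorm_mono (m : ℕ) {a b : ℕ} (h : a ≤ b) :
    canonicalNorm m a ≤ canonicalNorm m b := by
  refine Finset.sum_le_sum fun k _ => ?_
  gcongr

theorem one_le_canonicalNorm {m n : ℕ} (h : m < n) : 1 ≤ canonicalNorm m n := by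
  have h1 := Finset.single_le_sum (s := Finset.range (m + 1))
    (f := fun k => (n.choose k : ℝ) * ((n - k - 1).choose (m - k) : ℝ))
    (fun k _ => by positivity) (Finset.mem_range.2 (Nat.lt_succ_self m))
  refine le_trans ?_ h1
  have h2 : 0 < n.choose m := Nat.choose_pos h.le
  simp only [Nat.sub_self, Nat.choose_zero_right, Nat.cast_one, mul_one]
  exact_mod_cast h2

theorem sum_powerset_choose_eq_canonicalNorm {X : Type*} {m : ℕ} {A : Finset X}
    (hA : m < A.card) :
    ∑ B ∈ A.powerset, (if B.card ≤ m then ((A.card - B.card - 1).choose (m - B.card) : ℝ) else 0) =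
      canonicalNorm m A.card := by
  rw [Finset.sum_powerset_apply_card
    (fun j => if j ≤ m then ((A.card - j - 1).choose (m - j) : ℝ) else 0), canonicalNorm]
  symm
  refine Finset.sum_subset_zero_on_sdiff ?_ ?_ ?_
  · intro j hj
    rw [Finset.mem_range] at *
    omega
  · intro j hj
    rw [Finset.mem_sdiff, Finset.mem_range, Finset.mem_range] at hj
    rw [if_neg (by omega), smul_zero]
  · intro j hj
    rw [Finset.mem_range] at hj
    rw [if_pos (by omega), nsmul_eq_mul]

/-! ### Monomials and approximation by finitely many coordinates -/

section

variable {X : Type*} {m n : ℕ}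

/-- The finite set whose characteristic function is a given point of `σ_n(2^X)`. -/
noncomputable def sigmaSupport (u : sigmaSet X n) : Finset X := u.2.choose

theorem card_sigmaSupport (u : sigmaSet X n) : (sigmaSupport u).card ≤ n := u.2.choose_spec.1

theorem sigmaPoint_sigmaSupport (u : sigmaSet X n) :
    sigmaPoint (sigmaSupport u) (card_sigmaSupport u) = u := Subtype.ext u.2.choose_spec.2

theorem chi_injective : Function.Injective (chi : Finset X → X → Bool) := by
  intro A B h
  ext x
  simpa [chi] using congrFun h x

theorem sigmaSupport_sigmaPoint (A : Finset X) (hA : A.card ≤ n) :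
    sigmaSupport (sigmaPoint A hA) = A :=
  chi_injective (congrArg Subtype.val (sigmaPoint_sigmaSupport (sigmaPoint A hA)))

/-- The monomial `χ_A ↦ ∏_{x ∈ S} χ_A(x)` on `σ_n(2^X)`. -/
def monomialFun (n : ℕ) (S : Finset X) : C(sigmaSet X n, ℝ) where
  toFun u := ∏ x ∈ S, if u.1 x then 1 else 0
  continuous_toFun := by
    refine continuous_finsetProd _ fun x _ => ?_
    exact (continuous_of_discreteTopology (f := fun b : Bool => if b then (1 : ℝ) else 0)).comp
      ((continuous_apply x).comp continuous_subtype_val)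

open Classical in
theorem monomialFun_sigmaPoint (S A : Finset X) (hA : A.card ≤ n) :
    monomialFun n S (sigmaPoint A hA) = if S ⊆ A then 1 else 0 := by
  change (∏ x ∈ S, if chi A x = true then (1 : ℝ) else 0) = _
  rw [Finset.prod_boole]
  simp [chi, Finset.subset_iff]

theorem monomialFun_mul [DecidableEq X] (S R : Finset X) :
    monomialFun n S * monomialFun n R = monomialFun n (S ∪ R) := by
  ext u
  rw [← sigmaPoint_sigmaSupport u, ContinuousMap.mul_apply]
  simp only [monomialFun_sigmaPoint, Finset.union_subset_iff]
  split_ifs <;> simp_all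

/-- The monomials span a dense subspace. -/
theorem dense_span_monomialFun :
    Dense (Submodule.span ℝ (Set.range (monomialFun (X := X) n)) : Set C(sigmaSet X n, ℝ)) := by
  classical
  -- Products of monomials are monomials, so the algebra they generate is just their span.
  let M : Submonoid C(sigmaSet X n, ℝ) :=
    { carrier := Set.range (monomialFun (X := X) n)
      one_mem' := ⟨∅, by ext u; simp [monomialFun]⟩
      mul_mem' := by
        rintro _ _ ⟨S, rfl⟩ ⟨R, rfl⟩
        exact ⟨S ∪ R, (monomialFun_mul S R).symm⟩ }
  have hsep : (Algebra.adjoin ℝ (M : Set C(sigmaSet X n, ℝ))).SeparatesPoints := by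
    intro u v huv
    obtain ⟨x, hx⟩ : ∃ x, u.1 x ≠ v.1 x := by
      by_contra! h
      exact huv (Subtype.ext (funext h))
    refine ⟨_, ⟨monomialFun n {x}, Algebra.subset_adjoin ⟨{x}, rfl⟩, rfl⟩, ?_⟩
    simp only [monomialFun, ContinuousMap.coe_mk, Finset.prod_singleton]
    cases hu : u.1 x <;> cases hv : v.1 x <;> simp_all
  have h1 := ContinuousMap.subalgebra_topologicalClosure_eq_top_of_separatesPoints _ hsep
  have h2 : (Algebra.adjoin ℝ (M : Set C(sigmaSet X n, ℝ)) : Set C(sigmaSet X n, ℝ)) =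
      Submodule.span ℝ (Set.range (monomialFun (X := X) n)) := by
    have h3 := Algebra.adjoin_eq_span ℝ (M : Set C(sigmaSet X n, ℝ))
    rw [Submonoid.closure_eq] at h3
    exact congrArg (fun s : Submodule ℝ C(sigmaSet X n, ℝ) => (s : Set C(sigmaSet X n, ℝ))) h3
  rw [← h2, dense_iff_closure_eq, ← Subalgebra.topologicalClosure_coe, h1]
  rfl

-- For a monomial `e_S` and `F ⊇ S`, the conditions `S ⊆ A` and `S ⊆ A ∩ F` agree. Allowing every
-- larger `F` lets the sets for two summands be united.
open Classical in
theorem exists_finset_forall_eq_inter {p : C(sigmaSet X n, ℝ)}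
    (hp : p ∈ Submodule.span ℝ (Set.range (monomialFun (X := X) n))) :
    ∃ F₀ : Finset X, ∀ F, F₀ ⊆ F → ∀ (A : Finset X) (hA : A.card ≤ n),
      p (sigmaPoint A hA) =
        p (sigmaPoint (A ∩ F) ((Finset.card_le_card Finset.inter_subset_left).trans hA)) := by
  induction hp using Submodule.span_induction with
  | mem p hp =>
    obtain ⟨S, rfl⟩ := hp
    refine ⟨S, fun F hF A hA => ?_⟩
    simp [monomialFun_sigmaPoint, Finset.subset_inter_iff, hF]
  | zero => exact ⟨∅, fun _ _ _ _ => rfl⟩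
  | add p q _ _ hp hq =>
    obtain ⟨F₁, h₁⟩ := hp
    obtain ⟨F₂, h₂⟩ := hq
    refine ⟨F₁ ∪ F₂, fun F hF A hA => ?_⟩
    rw [ContinuousMap.add_apply, ContinuousMap.add_apply,
      h₁ F (Finset.subset_union_left.trans hF) A hA, h₂ F (Finset.subset_union_right.trans hF) A hA]
  | smul c p _ hp =>
    obtain ⟨F₁, h₁⟩ := hp
    refine ⟨F₁, fun F hF A hA => ?_⟩
    rw [ContinuousMap.smul_apply, ContinuousMap.smul_apply, h₁ F hF A hA]

open Classical in
/-- A continuous function on `σ_n(2^X)` depends on finitely many coordinates up to `ε`. -/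
theorem exists_finset_abs_sub_inter_le (g : C(sigmaSet X n, ℝ)) {ε : ℝ} (hε : 0 < ε) :
    ∃ F₀ : Finset X, ∀ F, F₀ ⊆ F → ∀ (A : Finset X) (hA : A.card ≤ n),
      |g (sigmaPoint A hA) - g (sigmaPoint (A ∩ F)
        ((Finset.card_le_card Finset.inter_subset_left).trans hA))| ≤ ε := by
  obtain ⟨p, hp, hgp⟩ := Metric.mem_closure_iff.1
    (dense_span_monomialFun (X := X) (n := n) g) (ε / 2) (half_pos hε)
  obtain ⟨F₀, hF₀⟩ := exists_finset_forall_eq_inter hp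
  refine ⟨F₀, fun F hF A hA => ?_⟩
  have h1 : ∀ u, |g u - p u| ≤ ε / 2 := fun u =>
    (ContinuousMap.dist_apply_le_dist (f := g) (g := p) u).trans hgp.le
  have h2 := abs_le.1 (h1 (sigmaPoint A hA))
  have h3 := abs_le.1 (h1 (sigmaPoint (A ∩ F)
    ((Finset.card_le_card Finset.inter_subset_left).trans hA)))
  have h4 := hF₀ F hF A hA
  rw [abs_le]
  constructor <;> linarith [h2.1, h2.2, h3.1, h3.2]

/-! ### The canonical operator -/

/-- The values of a function on `σ_m(2^X)` at finite sets, extended by zero to sets with more than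
`m` elements. -/
noncomputable def valueAt (f : C(sigmaSet X m, ℝ)) (B : Finset X) : ℝ :=
  if h : B.card ≤ m then f (sigmaPoint B h) else 0

theorem valueAt_add (f g : C(sigmaSet X m, ℝ)) (B : Finset X) :
    valueAt (f + g) B = valueAt f B + valueAt g B := by
  unfold valueAt
  split_ifs <;> simp

theorem valueAt_smul (c : ℝ) (f : C(sigmaSet X m, ℝ)) (B : Finset X) :
    valueAt (c • f) B = c * valueAt f B := by
  unfold valueAt
  split_ifs <;> simp

theorem abs_valueAt_le (f : C(sigmaSet X m, ℝ)) (B : Finset X) :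
    |valueAt f B| ≤ if B.card ≤ m then ‖f‖ else 0 := by
  unfold valueAt
  split_ifs
  · exact f.norm_coe_le_norm _
  · simp

open Classical in
theorem valueAt_monomialFun (S B : Finset X) :
    valueAt (monomialFun m S) B = if B.card ≤ m then (if S ⊆ B then 1 else 0) else 0 := by
  unfold valueAt
  split_ifs <;> simp_all [monomialFun_sigmaPoint]

/-- The value at `χ_A` of the image of `f` under the canonical operator. -/
noncomputable def canonicalValue (f : C(sigmaSet X m, ℝ)) (A : Finset X) : ℝ :=
  if A.card ≤ m then valueAt f A
  else ∑ B ∈ A.powerset, canonicalCoeff m A.card B.card * valueAt f B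

theorem canonicalValue_add (f g : C(sigmaSet X m, ℝ)) (A : Finset X) :
    canonicalValue (f + g) A = canonicalValue f A + canonicalValue g A := by
  unfold canonicalValue
  split_ifs
  · exact valueAt_add f g A
  · simp only [valueAt_add, mul_add, Finset.sum_add_distrib]

theorem canonicalValue_smul (c : ℝ) (f : C(sigmaSet X m, ℝ)) (A : Finset X) :
    canonicalValue (c • f) A = c * canonicalValue f A := by
  unfold canonicalValue
  split_ifs
  · exact valueAt_smul c f A
  · simp only [valueAt_smul, Finset.mul_sum]
    exact Finset.sum_congr rfl fun B _ => by ring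

theorem abs_canonicalValue_le (hmn : m < n) (f : C(sigmaSet X m, ℝ)) {A : Finset X}
    (hA : A.card ≤ n) : |canonicalValue f A| ≤ canonicalNorm m n * ‖f‖ := by
  unfold canonicalValue
  split_ifs with h
  · refine (abs_valueAt_le f A).trans ?_
    rw [if_pos h]
    exact le_mul_of_one_le_left (norm_nonneg f) (one_le_canonicalNorm hmn)
  · rw [not_le] at h
    refine (Finset.abs_sum_le_sum_abs _ _).trans ?_
    calc ∑ B ∈ A.powerset, |canonicalCoeff m A.card B.card * valueAt f B|
        ≤ ∑ B ∈ A.powerset,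
          (if B.card ≤ m then ((A.card - B.card - 1).choose (m - B.card) : ℝ) else 0) * ‖f‖ := by
          refine Finset.sum_le_sum fun B _ => ?_
          have h1 := abs_valueAt_le f B
          rw [abs_mul, canonicalCoeff, abs_mul, abs_pow, abs_neg, abs_one, one_pow, one_mul,
            Nat.abs_cast]
          split_ifs at h1 ⊢
          · exact mul_le_mul_of_nonneg_left h1 (Nat.cast_nonneg _)
          · rw [abs_nonpos_iff.1 h1]
            simp
      _ = canonicalNorm m A.card * ‖f‖ := by
          rw [← Finset.sum_mul, sum_powerset_choose_eq_canonicalNorm h]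
      _ ≤ canonicalNorm m n * ‖f‖ :=
          mul_le_mul_of_nonneg_right (canonicalNorm_mono m hA) (norm_nonneg f)

open Classical in
theorem canonicalValue_monomialFun {S : Finset X} (hS : S.card ≤ m) (A : Finset X) :
    canonicalValue (monomialFun m S) A = if S ⊆ A then 1 else 0 := by
  unfold canonicalValue
  split_ifs with h h1 h1
  · rw [valueAt_monomialFun, if_pos h, if_pos h1]
  · rw [valueAt_monomialFun, if_pos h, if_neg h1]
  · simp only [valueAt_monomialFun]
    rw [sum_canonicalCoeff_mul_ite (not_le.1 h) hS, if_pos h1]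
  · simp only [valueAt_monomialFun]
    rw [sum_canonicalCoeff_mul_ite (not_le.1 h) hS, if_neg h1]

theorem monomialFun_eq_zero {S : Finset X} (hS : m < S.card) : monomialFun m S = 0 := by
  classical
  ext u
  rw [← sigmaPoint_sigmaSupport u, monomialFun_sigmaPoint, if_neg]
  · rfl
  · intro h
    have := Finset.card_le_card h
    have := card_sigmaSupport u
    omega

/-- On the span of the monomials the image is again a combination of monomials; the norm bound makes
the general case a uniform limit of these. -/
theorem continuous_canonicalValue (hmn : m < n) (f : C(sigmaSet X m, ℝ)) :
    Continuous fun u : sigmaSet X n => canonicalValue f (sigmaSupport u) := by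
  classical
  have hspan : ∀ p ∈ Submodule.span ℝ (Set.range (monomialFun (X := X) m)),
      Continuous fun u : sigmaSet X n => canonicalValue p (sigmaSupport u) := by
    intro p hp
    have hzero : Continuous fun u : sigmaSet X n =>
        canonicalValue (0 : C(sigmaSet X m, ℝ)) (sigmaSupport u) := by
      have h (A : Finset X) : canonicalValue (0 : C(sigmaSet X m, ℝ)) A = 0 := by
        simpa using canonicalValue_smul 0 (0 : C(sigmaSet X m, ℝ)) A
      simp only [h]
      exact continuous_const
    induction hp using Submodule.span_induction with
    | mem p hp =>
      obtain ⟨S, rfl⟩ := hp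
      by_cases hS : S.card ≤ m
      · convert (monomialFun n S).continuous using 2 with u
        rw [canonicalValue_monomialFun hS]
        conv_rhs => rw [← sigmaPoint_sigmaSupport u, monomialFun_sigmaPoint]
      · rw [monomialFun_eq_zero (not_le.1 hS)]
        exact hzero
    | zero => exact hzero
    | add p q _ _ hp hq =>
      simp only [canonicalValue_add]
      exact hp.add hq
    | smul c p _ hp =>
      simp only [canonicalValue_smul]
      exact continuous_const.mul hp
  refine continuous_of_uniform_approx_of_continuous fun V hV => ?_
  obtain ⟨ε, hε, hV⟩ := Metric.mem_uniformity_dist.1 hV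
  have hC : 0 < canonicalNorm m n := zero_lt_one.trans_le (one_le_canonicalNorm hmn)
  obtain ⟨p, hp, hfp⟩ := Metric.mem_closure_iff.1
    (dense_span_monomialFun (X := X) (n := m) f) (ε / canonicalNorm m n) (div_pos hε hC)
  refine ⟨_, hspan p hp, fun u => hV ?_⟩
  have h1 : canonicalValue f (sigmaSupport u) - canonicalValue p (sigmaSupport u) =
      canonicalValue (f - p) (sigmaSupport u) := by
    rw [sub_eq_iff_eq_add, ← canonicalValue_add, sub_add_cancel]
  rw [Real.dist_eq, h1]
  refine (abs_canonicalValue_le hmn _ (card_sigmaSupport u)).trans_lt ?_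
  rw [← dist_eq_norm, mul_comm]
  exact (lt_div_iff₀ hC).1 hfp

/-- The canonical extension operator `C(σ_m(2^X)) → C(σ_n(2^X))`. -/
noncomputable def canonicalOperator (X : Type*) {m n : ℕ} (hmn : m < n) :
    C(sigmaSet X m, ℝ) →L[ℝ] C(sigmaSet X n, ℝ) :=
  LinearMap.mkContinuous
    { toFun := fun f => ⟨_, continuous_canonicalValue hmn f⟩
      map_add' := fun f g => by
        ext u
        exact canonicalValue_add f g _
      map_smul' := fun c f => by
        ext u
        exact canonicalValue_smul c f _ }
    (canonicalNorm m n) fun f => by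
      refine (ContinuousMap.norm_le _ (mul_nonneg
        (zero_le_one.trans (one_le_canonicalNorm hmn)) (norm_nonneg f))).2 fun u => ?_
      exact abs_canonicalValue_le hmn f (card_sigmaSupport u)

theorem canonicalOperator_sigmaPoint (hmn : m < n) (f : C(sigmaSet X m, ℝ)) (A : Finset X)
    (hA : A.card ≤ n) : canonicalOperator X hmn f (sigmaPoint A hA) = canonicalValue f A := by
  change canonicalValue f (sigmaSupport (sigmaPoint A hA)) = _
  rw [sigmaSupport_sigmaPoint]

theorem norm_canonicalOperator_le (hmn : m < n) :
    ‖canonicalOperator X hmn‖ ≤ canonicalNorm m n :=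
  LinearMap.mkContinuous_norm_le _ (zero_le_one.trans (one_le_canonicalNorm hmn)) _

theorem isCanonicalOperator_canonicalOperator (hmn : m < n) :
    IsCanonicalOperator (canonicalOperator X hmn) := by
  intro f A hA
  rw [canonicalOperator_sigmaPoint, canonicalValue]
  refine ⟨fun hm => ?_, fun hm => ?_⟩
  · rw [if_pos hm, valueAt, dif_pos hm]
  · rw [if_neg (not_le.2 hm), ← Finset.sum_filter_of_ne (p := fun B => B.card ≤ m),
      ← Finset.sum_attach]
    · refine Finset.sum_congr rfl fun B _ => ?_
      rw [valueAt, dif_pos (Finset.mem_filter.1 B.2).2, canonicalCoeff]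
    · intro B _ hB
      by_contra h
      exact hB (by rw [valueAt, dif_neg h, mul_zero])

theorem isExtensionOperator_canonicalOperator (hmn : m < n) :
    IsExtensionOperator (sigmaSet_mono X hmn.le) (canonicalOperator X hmn) := by
  intro f u
  have hu := card_sigmaSupport u
  have h1 := (isCanonicalOperator_canonicalOperator hmn f _ (hu.trans hmn.le)).1 hu
  rw [sigmaPoint_sigmaSupport] at h1
  rw [← h1]
  congr 1
  exact Subtype.ext (congrArg Subtype.val (sigmaPoint_sigmaSupport u)).symm

/-! ### The lower bound -/

open Classical in
/-- The function `χ_C ↦ (-1)^(m + |A ∩ C|)` on `σ_m(2^X)`. -/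
noncomputable def signFun (m : ℕ) (A : Finset X) : C(sigmaSet X m, ℝ) :=
  ∑ R ∈ A.powerset with R.card ≤ m, ((-1 : ℝ) ^ m * (-2) ^ R.card) • monomialFun m R

-- Expand `(-2 + 1)^|A ∩ C|` over subsets of `A ∩ C`; as `|C| ≤ m`, the restriction `|R| ≤ m` loses
-- nothing.
open Classical in
theorem signFun_sigmaPoint (A C : Finset X) (hC : C.card ≤ m) :
    signFun m A (sigmaPoint C hC) = (-1) ^ m * (-1) ^ (A ∩ C).card := by
  have h1 := Finset.sum_pow_mul_eq_add_pow (-2 : ℝ) 1 (A ∩ C)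
  simp only [one_pow, mul_one] at h1
  rw [show (-1 : ℝ) = -2 + 1 by norm_num, ← h1, signFun, ContinuousMap.sum_apply, Finset.mul_sum]
  symm
  refine Finset.sum_subset_zero_on_sdiff ?_ ?_ ?_
  · intro R hR
    have hR' := Finset.subset_inter_iff.1 (Finset.mem_powerset.1 hR)
    exact Finset.mem_filter.2
      ⟨Finset.mem_powerset.2 hR'.1, (Finset.card_le_card hR'.2).trans hC⟩
  · intro R hR
    simp only [Finset.mem_sdiff, Finset.mem_filter, Finset.mem_powerset,
      Finset.subset_inter_iff, not_and] at hR
    rw [ContinuousMap.smul_apply, monomialFun_sigmaPoint, if_neg (hR.2 hR.1.1), smul_zero]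
  · intro R hR
    have hR' := Finset.subset_inter_iff.1 (Finset.mem_powerset.1 hR)
    rw [ContinuousMap.smul_apply, monomialFun_sigmaPoint, if_pos hR'.2, smul_eq_mul, mul_one]
    norm_num

theorem norm_signFun_le (A : Finset X) : ‖signFun m A‖ ≤ 1 := by
  classical
  refine (ContinuousMap.norm_le _ zero_le_one).2 fun u => ?_
  rw [← sigmaPoint_sigmaSupport u, signFun_sigmaPoint]
  simp

-- Both sides evaluate the canonical operator on `signFun m A` at `χ_A`: through monomials, each
-- contributing its coefficient, and through the defining formula, where the signs cancel.
open Classical in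
theorem sum_signFun_coeff {A : Finset X} (hA : m < A.card) :
    ∑ R ∈ A.powerset with R.card ≤ m, (-1 : ℝ) ^ m * (-2) ^ R.card = canonicalNorm m A.card := by
  have h1 : canonicalOperator X hA (signFun m A) (sigmaPoint A le_rfl) =
      ∑ R ∈ A.powerset with R.card ≤ m, (-1 : ℝ) ^ m * (-2) ^ R.card := by
    rw [signFun, map_sum, ContinuousMap.sum_apply]
    refine Finset.sum_congr rfl fun R hR => ?_
    rw [Finset.mem_filter, Finset.mem_powerset] at hR
    rw [map_smul, ContinuousMap.smul_apply, canonicalOperator_sigmaPoint,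
      canonicalValue_monomialFun hR.2, if_pos hR.1, smul_eq_mul, mul_one]
  rw [← h1, canonicalOperator_sigmaPoint, canonicalValue, if_neg (not_le.2 hA),
    ← sum_powerset_choose_eq_canonicalNorm hA]
  refine Finset.sum_congr rfl fun B hB => ?_
  rw [valueAt]
  split_ifs with h
  · rw [signFun_sigmaPoint, Finset.inter_eq_right.2 (Finset.mem_powerset.1 hB), canonicalCoeff,
      ← pow_add]
    have h2 : (-1 : ℝ) ^ (m - B.card) * (-1) ^ (m + B.card) = 1 := by
      rw [← pow_add]
      exact Even.neg_one_pow ⟨m, by omega⟩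
    linear_combination ((A.card - B.card - 1).choose (m - B.card) : ℝ) * h2
  · simp

/-- Lower bound for the norm of an extension operator. -/
theorem canonicalNorm_le_norm (hmn : m < n)
    (hX : Cardinal.aleph ((n - 1 : ℕ) : Ordinal) ≤ Cardinal.mk X)
    {T : C(sigmaSet X m, ℝ) →L[ℝ] C(sigmaSet X n, ℝ)}
    (hT : IsExtensionOperator (sigmaSet_mono X hmn.le) T) : canonicalNorm m n ≤ ‖T‖ := by
  classical
  refine le_of_forall_pos_le_add fun δ hδ => ?_
  -- The coefficients of `signFun` have absolute values `2^|R|`, and `∑ 2^|R| = 3^n` over all `R ⊆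
  -- A`.
  obtain ⟨ε, hε, hεδ⟩ : ∃ ε : ℝ, 0 < ε ∧ ε * 3 ^ n = δ :=
    ⟨δ / 3 ^ n, by positivity, by field_simp⟩
  have hF : ∀ R : Finset X, ∃ F, R ⊆ F ∧ ∀ (A : Finset X) (hA : A.card ≤ n),
      |T (monomialFun m R) (sigmaPoint A hA) - T (monomialFun m R) (sigmaPoint (A ∩ F)
        ((Finset.card_le_card Finset.inter_subset_left).trans hA))| ≤ ε := by
    intro R
    obtain ⟨F₀, hF₀⟩ := exists_finset_abs_sub_inter_le (T (monomialFun m R)) hε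
    exact ⟨R ∪ F₀, Finset.subset_union_left, hF₀ _ Finset.subset_union_right⟩
  choose F hRF hF using hF
  -- The union over subsets makes freeness apply to every `R ⊆ A \ {x}`: if `x ∈ A \ R`, then `x ∉ F
  -- R`.
  obtain ⟨A, -, hcard, hfree⟩ := exists_free_finset (n - 1) (Set.univ : Set X)
    (by rwa [Cardinal.mk_univ]) fun B => B.powerset.biUnion F
  have hAn : A.card = n := by omega
  have hinter : ∀ R ⊆ A, A ∩ F R = R := by
    intro R hRA
    refine Finset.Subset.antisymm (fun x hx => ?_) (Finset.subset_inter hRA (hRF R))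
    rw [Finset.mem_inter] at hx
    by_contra hxR
    exact hfree x hx.1 (Finset.mem_biUnion.2
      ⟨R, Finset.mem_powerset.2 (Finset.subset_erase.2 ⟨hRA, hxR⟩), hx.2⟩)
  have hnear : ∀ R ⊆ A, R.card ≤ m →
      |T (monomialFun m R) (sigmaPoint A hAn.le) - 1| ≤ ε := by
    intro R hRA hRm
    have h1 := hF R A hAn.le
    have h2 : T (monomialFun m R) (sigmaPoint R (hRm.trans hmn.le)) = 1 := by
      refine (hT (monomialFun m R) (sigmaPoint R hRm)).trans ?_
      rw [monomialFun_sigmaPoint, if_pos subset_rfl]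
    simp only [hinter R hRA, h2] at h1
    exact h1
  have hle : T (signFun m A) (sigmaPoint A hAn.le) ≤ ‖T‖ :=
    calc T (signFun m A) (sigmaPoint A hAn.le) ≤ ‖T (signFun m A)‖ :=
          (le_abs_self _).trans ((T (signFun m A)).norm_coe_le_norm _)
      _ ≤ ‖T‖ * ‖signFun m A‖ := T.le_opNorm _
      _ ≤ ‖T‖ := mul_le_of_le_one_right (norm_nonneg T) (norm_signFun_le A)
  have hdiff : |T (signFun m A) (sigmaPoint A hAn.le) - canonicalNorm m n| ≤ δ := by
    have hsum := sum_signFun_coeff (m := m) (A := A) (by omega)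
    rw [hAn] at hsum
    rw [← hsum, signFun, map_sum, ContinuousMap.sum_apply,
      ← Finset.sum_sub_distrib, ← hεδ]
    refine (Finset.abs_sum_le_sum_abs _ _).trans ?_
    have h3 := Finset.sum_pow_mul_eq_add_pow (2 : ℝ) 1 A
    simp only [one_pow, mul_one, hAn] at h3
    rw [show (3 : ℝ) = 2 + 1 by norm_num, ← h3, Finset.mul_sum]
    refine (Finset.sum_le_sum fun R hR => ?_).trans (Finset.sum_le_sum_of_subset_of_nonneg
      (Finset.filter_subset (fun R : Finset X => R.card ≤ m) _) fun R _ _ => by positivity)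
    rw [Finset.mem_filter, Finset.mem_powerset] at hR
    rw [map_smul, ContinuousMap.smul_apply, smul_eq_mul, ← mul_sub_one, abs_mul, abs_mul, abs_pow,
      abs_pow, abs_neg, abs_neg, abs_one, one_pow, one_mul, abs_two, mul_comm]
    exact mul_le_mul_of_nonneg_right (hnear R hR.1 hR.2) (by positivity)
  linarith [(abs_le.1 hdiff).1]

end

theorem mainTheorem3 {X : Type*} (m n : ℕ) (hmn : m < n)
    (hX : Cardinal.aleph ((n - 1 : ℕ) : Ordinal) ≤ Cardinal.mk X) :
    ∃ T : C(sigmaSet X m, ℝ) →L[ℝ] C(sigmaSet X n, ℝ),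
      IsCanonicalOperator T ∧
      IsExtensionOperator (sigmaSet_mono X hmn.le) T ∧
      extensionConstant (sigmaSet_mono X hmn.le) = ENNReal.ofReal ‖T‖ ∧
      ‖T‖ = ∑ k ∈ Finset.range (m + 1), (n.choose k : ℝ) * ((n - k - 1).choose (m - k) : ℝ) := by
  have hext := isExtensionOperator_canonicalOperator (X := X) hmn
  refine ⟨canonicalOperator X hmn, isCanonicalOperator_canonicalOperator hmn, hext, ?_,
    (norm_canonicalOperator_le hmn).antisymm (canonicalNorm_le_norm hmn hX hext)⟩
  refine le_antisymm (iInf₂_le _ hext) (le_iInf₂ fun S hS => ENNReal.ofReal_le_ofReal ?_)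
  exact (norm_canonicalOperator_le hmn).trans (canonicalNorm_le_norm hmn hX hS)
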